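/- For a finite connected graph $G$, regarded as an electrical network in which every edge is a unit resistor, let $r_G(u,v)$ denote the resistance distance (effective resistance) between the vertices $u$ and $v$, i.e. the potential difference between $u$ and $v$ when a unit current enters at $u$ and leaves at $v$, and let $$K\!f(G)=\sum_{\{u,v\}\subseteq V_G} r_G(u,v)$$ be the Kirchhoff index of $G$, the sum being over unordered pairs of vertices. For $n\ge 1$ let $L_n$ be the linear hexagonal chain with $n$ hexagons: its vertices are $p_0,\dots,p_n$, $q_0,\dots,q_n$, $u_0,\dots,u_{n-1}$, $v_0,\dots,v_{n-1}$, and its edges are $p_iq_i$ for $0\le i\le n$ together with $p_iu_i$, $u_ip_{i+1}$, $q_iv_i$, $v_iq_{i+1}$ for $0\le i\le n-1$. For $n\ge 2$ let $R_n$ be the linear hexagonal cylinder chain, obtained from $L_n$ by identifying $p_n$ with $p_0$, $q_n$ with $q_0$, and the edge $p_nq_n$ with the edge $p_0q_0$. Then $$\lim_{n\to\infty}\frac{K\!f(R_n)}{K\!f(L_n)}=\frac12 .$$ -/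

import Mathlib

/-- `x` is a vector of node potentials in the electrical network obtained from `G` by replacing every
edge by a unit resistor, when a unit current enters at `u` and leaves at `v`: by Ohm's law the current
along an edge `w w'` is `x w - x w'`, and by Kirchhoff's current law the net current leaving `w`, which
is `∑ w' ∼ w, (x w - x w') = (L x) w` for the graph Laplacian `L`, is `1` at `u`, `-1` at `v` and `0`
elsewhere (and is `0` everywhere if `u = v`). -/
def IsUnitCurrentPotential {V : Type*} [Fintype V] [DecidableEq V] (G : SimpleGraph V)
    [DecidableRel G.Adj] (u v : V) (x : V → ℝ) : Prop :=
  Matrix.mulVec (G.lapMatrix ℝ) x = Pi.single u 1 - Pi.single v 1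

open Classical in
/-- The resistance distance (effective resistance) between `u` and `v`: the potential difference
between `u` and `v` when a unit current enters at `u` and leaves at `v`. In a connected graph such
potentials exist; the value does not depend on the chosen one, see `resistanceDist_eq`.
(The value `0` for `u`, `v` in different components is a convention that plays no role for
connected graphs.) -/
noncomputable def resistanceDist {V : Type*} [Fintype V] [DecidableEq V] (G : SimpleGraph V)
    [DecidableRel G.Adj] (u v : V) : ℝ :=
  if h : ∃ x : V → ℝ, IsUnitCurrentPotential G u v x then h.choose u - h.choose v else 0

/-- The resistance distance is well defined: every potential vector gives the same value. -/
theorem resistanceDist_eq {V : Type*} [Fintype V] [DecidableEq V] (G : SimpleGraph V)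
    [DecidableRel G.Adj] (u v : V) (x : V → ℝ) (hx : IsUnitCurrentPotential G u v x) :
    resistanceDist G u v = x u - x v := by
  have h : ∃ x : V → ℝ, IsUnitCurrentPotential G u v x := ⟨x, hx⟩
  have hy := h.choose_spec
  rw [resistanceDist, dif_pos h]
  generalize h.choose = y at hy ⊢
  unfold IsUnitCurrentPotential at hx hy
  have key : x ⬝ᵥ Matrix.mulVec (G.lapMatrix ℝ) y = y ⬝ᵥ Matrix.mulVec (G.lapMatrix ℝ) x := by
    rw [Matrix.dotProduct_mulVec, ← Matrix.mulVec_transpose, (G.isSymm_lapMatrix (R := ℝ)).eq,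
      dotProduct_comm]
  rw [hx, hy] at key
  simpa [dotProduct_sub] using key.symm

/-- The Kirchhoff index: the sum of the resistance distances over all unordered pairs of vertices,
written as one half of the sum over ordered pairs (the diagonal terms vanish). -/
noncomputable def kirchhoffIndex {V : Type*} [Fintype V] [DecidableEq V] (G : SimpleGraph V)
    [DecidableRel G.Adj] : ℝ :=
  (1 / 2 : ℝ) * ∑ u : V, ∑ v : V, resistanceDist G u v

/-- Two disjoint copies of a graph `H` on the positions `0, …, m - 1` (the two rails, indexed by
`Bool`), joined by an edge (a rung) between the two copies of every even position. -/
def evenRungs {m : ℕ} (H : SimpleGraph (Fin m)) : SimpleGraph (Bool × Fin m) where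
  Adj a b := (a.1 = b.1 ∧ H.Adj a.2 b.2) ∨ (a.1 ≠ b.1 ∧ a.2 = b.2 ∧ Even (a.2 : ℕ))
  symm := ⟨by
    rintro a b (⟨h₁, h₂⟩ | ⟨h₁, h₂, h₃⟩)
    · exact Or.inl ⟨h₁.symm, h₂.symm⟩
    · exact Or.inr ⟨h₁.symm, h₂.symm, h₂ ▸ h₃⟩⟩
  loopless := ⟨by
    rintro a (⟨-, h⟩ | ⟨h, -⟩)
    · exact H.loopless.irrefl _ h
    · exact h rfl⟩

/-- The linear hexagonal chain `L_n` with `n` hexagons. Its rails are the paths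
`p_0, u_0, p_1, u_1, …, u_{n-1}, p_n` and `q_0, v_0, q_1, v_1, …, v_{n-1}, q_n`,
with `p_i = (false, 2 i)`, `u_i = (false, 2 i + 1)`, `q_i = (true, 2 i)`, `v_i = (true, 2 i + 1)`,
and its rungs are the edges `p_i q_i` for `0 ≤ i ≤ n`. -/
def hexChain (n : ℕ) : SimpleGraph (Bool × Fin (2 * n + 1)) :=
  evenRungs (SimpleGraph.pathGraph (2 * n + 1))

/-- The linear hexagonal cylinder chain `R_n` with `n` hexagons, obtained from `L_n` by identifying
`p_n` with `p_0`, `q_n` with `q_0` and the edge `p_n q_n` with `p_0 q_0`. With the same labels,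
its rails are the cycles `p_0, u_0, p_1, …, p_{n-1}, u_{n-1}` and `q_0, v_0, q_1, …, q_{n-1}, v_{n-1}`
of length `2 n`, and its rungs are the edges `p_i q_i` for `0 ≤ i < n`. (For `n ≥ 2` this is the
simple graph with `4 n` vertices and `5 n` edges.) -/
def hexCylinder (n : ℕ) : SimpleGraph (Bool × Fin (2 * n)) :=
  evenRungs (SimpleGraph.cycleGraph (2 * n))

open Classical in
noncomputable instance hexChain.decidableAdj (n : ℕ) : DecidableRel (hexChain n).Adj :=
  fun _ _ => inferInstance

open Classical in
noncomputable instance hexCylinder.decidableAdj (n : ℕ) : DecidableRel (hexCylinder n).Adj :=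
  fun _ _ => inferInstance

/-!
Both graphs are two copies (rails) of a graph `H` on `Fin m`, a path or a cycle, joined by rungs at
the even positions. Swapping the rails is a symmetry, so potentials split into a symmetric and an
antisymmetric part. On symmetric vectors the Laplacian acts as the Laplacian of `H`; on
antisymmetric ones it acts as `L_H + 2 D` with `D` the projection onto even positions
(`groundedLap`). As every position is even or adjacent to an even one, `L_H + 2 D` is bounded below
independently of `m` (`sq_le_energy`), hence the antisymmetric part contributes only a bounded
amount and every resistance distance is half of the one in `H` up to an error in `[0, 3]`
(`resistanceDist_evenRungs_mem_Icc`).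

Summing, the Kirchhoff index is the sum of the resistance distances of `H` over ordered pairs of
positions, up to `O(m²)` (`kirchhoffIndex_evenRungs_mem_Icc`). The resistance distance is `|i - j|`
on the path and `|i - j| - (i - j)² / m` on the cycle, so these sums are `(m³ - m) / 3` and
`(m³ - m) / 6`. As `m ~ 2 n` in both cases, the ratio tends to `1 / 2`.
-/

open Matrix

theorem SimpleGraph.lapMatrix_mulVec_eq_sum {V : Type*} [Fintype V] [DecidableEq V]
    (G : SimpleGraph V) [DecidableRel G.Adj] (x : V → ℝ) (v : V) :
    (G.lapMatrix ℝ *ᵥ x) v = ∑ w, if G.Adj v w then x v - x w else 0 := by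
  rw [G.lapMatrix_mulVec_apply, ← Finset.sum_filter, Finset.sum_sub_distrib,
    Finset.sum_const, nsmul_eq_mul, ← G.card_neighborFinset_eq_degree,
    G.neighborFinset_eq_filter]

/-! ### Reduction from the two-rail graph to a single rail -/

section EvenRungs

variable {m : ℕ} (H : SimpleGraph (Fin m)) [DecidableRel H.Adj]

theorem lapMatrix_evenRungs_mulVec [DecidableRel (evenRungs H).Adj]
    (x : Bool × Fin m → ℝ) (s : Bool) (a : Fin m) :
    ((evenRungs H).lapMatrix ℝ *ᵥ x) (s, a) =
      (H.lapMatrix ℝ *ᵥ fun b => x (s, b)) a +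
        if Even (a : ℕ) then x (s, a) - x (!s, a) else 0 := by
  have same (b : Fin m) : (evenRungs H).Adj (s, a) (s, b) ↔ H.Adj a b := by
    simp [evenRungs]
  have other (b : Fin m) :
      (evenRungs H).Adj (s, a) (!s, b) ↔ a = b ∧ Even (a : ℕ) := by
    simp [evenRungs]
  have split (F : Bool × Fin m → ℝ) :
      ∑ w, F w = (∑ b, F (s, b)) + ∑ b, F (!s, b) := by
    rw [Fintype.sum_prod_type, Fintype.sum_bool]
    cases s
    · exact add_comm _ _
    · rfl
  rw [SimpleGraph.lapMatrix_mulVec_eq_sum, SimpleGraph.lapMatrix_mulVec_eq_sum, split]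
  simp only [same, other, ite_and, Finset.sum_ite_eq, Finset.mem_univ, if_true]

/-- The operator `L_H + 2 D`, where `D` is the diagonal projection onto the even positions. It is
how the Laplacian of `evenRungs H` acts on vectors that change sign when the rails are swapped:
there a rung has potential difference `g a - (-g a) = 2 g a`. -/
def groundedLap : Matrix (Fin m) (Fin m) ℝ :=
  H.lapMatrix ℝ + diagonal fun a : Fin m => if Even (a : ℕ) then 2 else 0

theorem groundedLap_mulVec (g : Fin m → ℝ) (a : Fin m) :
    (groundedLap H *ᵥ g) a = (H.lapMatrix ℝ *ᵥ g) a + if Even (a : ℕ) then 2 * g a else 0 := by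
  rw [groundedLap, add_mulVec, Pi.add_apply, mulVec_diagonal, ite_mul, zero_mul]

/-- The energy of `g`: the Dirichlet energy of `H` plus that of the grounded even positions. -/
theorem dotProduct_groundedLap_mulVec (g : Fin m → ℝ) :
    g ⬝ᵥ (groundedLap H *ᵥ g) =
      (∑ a, ∑ b, if H.Adj a b then (g a - g b) ^ 2 else 0) / 2 +
        ∑ a : Fin m, if Even (a : ℕ) then 2 * g a ^ 2 else 0 := by
  rw [← H.lapMatrix_toLinearMap₂' ℝ g, toLinearMap₂'_apply', groundedLap, add_mulVec,
    dotProduct_add]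
  congr 1
  refine Finset.sum_congr rfl fun a _ => ?_
  rw [mulVec_diagonal]
  split_ifs <;> ring

theorem dotProduct_groundedLap_mulVec_nonneg (g : Fin m → ℝ) :
    0 ≤ g ⬝ᵥ (groundedLap H *ᵥ g) := by
  rw [dotProduct_groundedLap_mulVec]
  have h₁ : 0 ≤ ∑ a, ∑ b, if H.Adj a b then (g a - g b) ^ 2 else 0 :=
    Finset.sum_nonneg fun a _ => Finset.sum_nonneg fun b _ => by split_ifs <;> positivity
  have h₂ : 0 ≤ ∑ a : Fin m, if Even (a : ℕ) then 2 * g a ^ 2 else 0 :=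
    Finset.sum_nonneg fun a _ => by split_ifs <;> positivity
  linarith

/-- The energy controls a single edge together with a single even position. The edge is counted
twice in the double sum, which cancels the factor `1 / 2`. -/
theorem edge_add_ground_le {a b : Fin m} (hab : H.Adj a b) (hb : Even (b : ℕ)) (g : Fin m → ℝ) :
    (g a - g b) ^ 2 + 2 * g b ^ 2 ≤ g ⬝ᵥ (groundedLap H *ᵥ g) := by
  rw [dotProduct_groundedLap_mulVec]
  have hnn (a b : Fin m) : 0 ≤ if H.Adj a b then (g a - g b) ^ 2 else 0 := by
    split_ifs <;> positivity
  have single {p q : Fin m} (hpq : H.Adj p q) :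
      (g p - g q) ^ 2 ≤ ∑ b, if H.Adj p b then (g p - g b) ^ 2 else 0 := by
    simpa [hpq] using Finset.single_le_sum (fun b _ => hnn p b) (Finset.mem_univ q)
  have h₁ := Finset.add_le_sum (f := fun a => ∑ b, if H.Adj a b then (g a - g b) ^ 2 else 0)
    (fun a _ => Finset.sum_nonneg fun b _ => hnn a b) (Finset.mem_univ a) (Finset.mem_univ b)
    hab.ne
  have h₂ : 2 * g b ^ 2 ≤ ∑ a : Fin m, if Even (a : ℕ) then 2 * g a ^ 2 else 0 := by
    simpa [hb] using Finset.single_le_sum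
      (f := fun a : Fin m => if Even (a : ℕ) then 2 * g a ^ 2 else 0)
      (fun a _ => by split_ifs <;> positivity) (Finset.mem_univ b)
  have h₃ := single hab
  have h₄ := single hab.symm
  have h₅ : (g b - g a) ^ 2 = (g a - g b) ^ 2 := by ring
  linarith

variable {H}

/-- A potential at any position is controlled by the energy, since some position within distance
one is grounded. -/
theorem sq_le_energy (hH : ∀ a, ∃ b, H.Adj a b ∧ (Even (a : ℕ) ∨ Even (b : ℕ)))
    (g : Fin m → ℝ) (a : Fin m) : g a ^ 2 ≤ 3 / 2 * g ⬝ᵥ (groundedLap H *ᵥ g) := by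
  obtain ⟨b, hab, h | h⟩ := hH a
  · have := edge_add_ground_le H hab.symm h g
    nlinarith [sq_nonneg (g b - g a), sq_nonneg (g a)]
  · have := edge_add_ground_le H hab h g
    -- `(δ + y)² ≤ (1 + 1/2) (δ² + 2 y²)` with `δ = g a - g b` and `y = g b`
    nlinarith [sq_nonneg (g a - g b - 2 * g b)]

theorem groundedLap_mulVec_surjective
    (hH : ∀ a, ∃ b, H.Adj a b ∧ (Even (a : ℕ) ∨ Even (b : ℕ))) :
    Function.Surjective (groundedLap H).mulVec := by
  rw [mulVec_surjective_iff_isUnit, ← mulVec_injective_iff_isUnit]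
  refine (injective_iff_map_eq_zero (groundedLap H).mulVecLin).2 fun g hg => ?_
  rw [mulVecLin_apply] at hg
  ext a
  have := sq_le_energy hH g a
  rw [hg, dotProduct_zero, mul_zero] at this
  exact pow_eq_zero_iff two_ne_zero |>.1 (le_antisymm this (sq_nonneg _))

/-- The antisymmetric function on the two rails, `1` on the rail `false` and `-1` on the rail
`true`. -/
def railSign (s : Bool) : ℝ := if s then -1 else 1

theorem railSign_sq (s : Bool) : railSign s ^ 2 = 1 := by cases s <;> norm_num [railSign]

theorem railSign_not (s : Bool) : railSign (!s) = -railSign s := by cases s <;> simp [railSign]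

theorem single_rail_apply (s t : Bool) (i a : Fin m) :
    (Pi.single (t, i) 1 : Bool × Fin m → ℝ) (s, a) =
      (1 + railSign s * railSign t) / 2 * (Pi.single i 1 : Fin m → ℝ) a := by
  by_cases h : a = i <;> cases s <;> cases t <;> simp [h, railSign]

/-- A unit source at `(s, i)` is half the sum of the symmetric source `1` and the antisymmetric
source `railSign s` at position `i`, so a potential is the average of a symmetric one, from `f`,
and an antisymmetric one, from `g`. -/
theorem isUnitCurrentPotential_evenRungs [DecidableRel (evenRungs H).Adj] {i j : Fin m}
    {s t : Bool} {f g : Fin m → ℝ} (hf : IsUnitCurrentPotential H i j f)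
    (hg : groundedLap H *ᵥ g = railSign s • Pi.single i 1 - railSign t • Pi.single j 1) :
    IsUnitCurrentPotential (evenRungs H) (s, i) (t, j)
      fun w => (f w.2 + railSign w.1 * g w.2) / 2 := by
  ext ⟨r, a⟩
  have hfa := congrFun hf a
  have hga := congrFun hg a
  rw [groundedLap_mulVec] at hga
  have hlin : (fun b => (f b + railSign r * g b) / 2) =
      (1 / 2 : ℝ) • f + (railSign r / 2) • g := by
    ext b
    simp only [Pi.add_apply, Pi.smul_apply, smul_eq_mul]
    ring
  rw [lapMatrix_evenRungs_mulVec, hlin, mulVec_add, mulVec_smul, mulVec_smul, Pi.sub_apply,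
    single_rail_apply, single_rail_apply]
  simp only [Pi.add_apply, Pi.sub_apply, Pi.smul_apply, smul_eq_mul, railSign_not] at hfa hga ⊢
  rw [hfa, eq_sub_of_add_eq hga]
  split_ifs <;> ring

/-- Up to a bounded error, joining two copies of `H` by rungs halves the resistance distances. -/
theorem resistanceDist_evenRungs_mem_Icc [DecidableRel (evenRungs H).Adj]
    (hH : ∀ a, ∃ b, H.Adj a b ∧ (Even (a : ℕ) ∨ Even (b : ℕ))) {i j : Fin m}
    {f : Fin m → ℝ} (hf : IsUnitCurrentPotential H i j f) (s t : Bool) :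
    resistanceDist (evenRungs H) (s, i) (t, j) ∈
      Set.Icc ((f i - f j) / 2) ((f i - f j) / 2 + 3) := by
  obtain ⟨g, hg⟩ := groundedLap_mulVec_surjective hH
    (railSign s • Pi.single i 1 - railSign t • Pi.single j 1)
  rw [resistanceDist_eq _ _ _ _ (isUnitCurrentPotential_evenRungs hf hg)]
  have hE : g ⬝ᵥ (groundedLap H *ᵥ g) = railSign s * g i - railSign t * g j := by
    rw [hg]
    simp [dotProduct_sub]
  have h₀ := dotProduct_groundedLap_mulVec_nonneg H g
  have hi := sq_le_energy hH g i
  have hj := sq_le_energy hH g j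
  set E := g ⬝ᵥ (groundedLap H *ᵥ g)
  -- `E² ≤ 2 (g i)² + 2 (g j)² ≤ 6 E`
  have hE6 : E ≤ 6 := by
    have hs : (railSign s * g i) ^ 2 = g i ^ 2 := by rw [mul_pow, railSign_sq, one_mul]
    have ht : (railSign t * g j) ^ 2 = g j ^ 2 := by rw [mul_pow, railSign_sq, one_mul]
    have : E ^ 2 ≤ 6 * E := by
      rw [← hs] at hi
      rw [← ht] at hj
      nlinarith [sq_nonneg (railSign s * g i + railSign t * g j)]
    nlinarith
  constructor <;> dsimp only <;> linarith

/-- Of the `4` pairs of rails each contributes half of the resistance sum of `H`, and the Kirchhoff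
index counts unordered pairs, so the leading term is the sum over ordered pairs of positions. -/
theorem kirchhoffIndex_evenRungs_mem_Icc [DecidableRel (evenRungs H).Adj]
    (hH : ∀ a, ∃ b, H.Adj a b ∧ (Even (a : ℕ) ∨ Even (b : ℕ)))
    {f : Fin m → Fin m → Fin m → ℝ} (hf : ∀ i j, IsUnitCurrentPotential H i j (f i j)) :
    kirchhoffIndex (evenRungs H) ∈
      Set.Icc (∑ i, ∑ j, (f i j i - f i j j))
        ((∑ i, ∑ j, (f i j i - f i j j)) + 6 * (m : ℝ) ^ 2) := by
  have hb (s t : Bool) (i j : Fin m) := resistanceDist_evenRungs_mem_Icc hH (hf i j) s t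
  have hsum (s t : Bool) :
      ∑ i, ∑ j, resistanceDist (evenRungs H) (s, i) (t, j) ∈
        Set.Icc ((∑ i, ∑ j, (f i j i - f i j j)) / 2)
          ((∑ i, ∑ j, (f i j i - f i j j)) / 2 + 3 * (m : ℝ) ^ 2) := by
    simp only [Finset.sum_div]
    constructor
    · exact Finset.sum_le_sum fun i _ => Finset.sum_le_sum fun j _ => (hb s t i j).1
    · calc _ ≤ ∑ i, ∑ j, ((f i j i - f i j j) / 2 + 3) :=
            Finset.sum_le_sum fun i _ => Finset.sum_le_sum fun j _ => (hb s t i j).2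
        _ = _ := by
            simp only [Finset.sum_add_distrib, Finset.sum_const, Finset.card_univ,
              Fintype.card_fin, nsmul_eq_mul]
            ring
  have hK : kirchhoffIndex (evenRungs H) = 1 / 2 * ∑ s : Bool, ∑ t : Bool, ∑ i, ∑ j,
      resistanceDist (evenRungs H) (s, i) (t, j) := by
    simp only [kirchhoffIndex, Fintype.sum_prod_type]
    congr 1
    exact Finset.sum_congr rfl fun s _ => Finset.sum_comm
  rw [hK]
  simp only [Fintype.sum_bool]
  have h₁ := hsum true true
  have h₂ := hsum true false
  have h₃ := hsum false true
  have h₄ := hsum false false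
  constructor
  · linarith [h₁.1, h₂.1, h₃.1, h₄.1]
  · linarith [h₁.2, h₂.2, h₃.2, h₄.2]

end EvenRungs

/-! ### Potentials on the path and on the cycle -/

section RailPotentials

theorem Fin.sum_ite_val_eq {m : ℕ} (F : ℕ → ℝ) (c : ℕ) :
    (∑ b : Fin m, if (b : ℕ) = c then F b else 0) = if c < m then F c else 0 := by
  rw [Fin.sum_univ_eq_sum_range (fun b => if b = c then F b else 0) m, Finset.sum_ite_eq']
  simp only [Finset.mem_range]

theorem lapMatrix_pathGraph_mulVec {m : ℕ} [DecidableRel (SimpleGraph.pathGraph m).Adj]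
    (x : ℕ → ℝ) (a : Fin m) :
    ((SimpleGraph.pathGraph m).lapMatrix ℝ *ᵥ fun b => x b) a =
      (if (a : ℕ) + 1 < m then x a - x (a + 1) else 0) +
        if 0 < (a : ℕ) then x a - x (a - 1) else 0 := by
  have hterm (b : Fin m) :
      (if (SimpleGraph.pathGraph m).Adj a b then x a - x b else 0) =
        (if (b : ℕ) = a + 1 then x a - x b else 0) +
          if (b : ℕ) = a - 1 then (if 0 < (a : ℕ) then x a - x b else 0) else 0 := by
    simp only [SimpleGraph.pathGraph_adj]
    split_ifs <;> first | omega | simp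
  rw [SimpleGraph.lapMatrix_mulVec_eq_sum, Finset.sum_congr rfl fun b _ => hterm b,
    Finset.sum_add_distrib, Fin.sum_ite_val_eq (fun b => x a - x b),
    Fin.sum_ite_val_eq (fun b => if 0 < (a : ℕ) then x a - x b else 0),
    if_pos (show (a : ℕ) - 1 < m by omega)]

theorem cycleGraph_adj_iff_val {m : ℕ} (hm : 3 ≤ m) (a b : Fin m) :
    (SimpleGraph.cycleGraph m).Adj a b ↔
      (b : ℕ) = (if (a : ℕ) + 1 < m then (a : ℕ) + 1 else 0) ∨
        (b : ℕ) = if 0 < (a : ℕ) then (a : ℕ) - 1 else m - 1 := by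
  have := a.isLt
  have := b.isLt
  rw [SimpleGraph.cycleGraph_adj']
  rcases le_or_gt a b with h | h
  · rw [Fin.sub_val_of_le h]
    rcases h.eq_or_lt with rfl | h'
    · simp only [Fin.sub_val_of_le le_rfl]
      split_ifs <;> omega
    · rw [Fin.coe_sub_iff_lt.2 h']
      rw [Fin.lt_def] at h'
      split_ifs <;> omega
  · rw [Fin.sub_val_of_le h.le, Fin.coe_sub_iff_lt.2 h]
    rw [Fin.lt_def] at h
    split_ifs <;> omega

theorem lapMatrix_cycleGraph_mulVec {m : ℕ} (hm : 3 ≤ m)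
    [DecidableRel (SimpleGraph.cycleGraph m).Adj] (x : ℕ → ℝ) (a : Fin m) :
    ((SimpleGraph.cycleGraph m).lapMatrix ℝ *ᵥ fun b => x b) a =
      (x a - x (if (a : ℕ) + 1 < m then (a : ℕ) + 1 else 0)) +
        (x a - x (if 0 < (a : ℕ) then (a : ℕ) - 1 else m - 1)) := by
  have hterm (b : Fin m) :
      (if (SimpleGraph.cycleGraph m).Adj a b then x a - x b else 0) =
        (if (b : ℕ) = (if (a : ℕ) + 1 < m then (a : ℕ) + 1 else 0) then x a - x b else 0) +
          if (b : ℕ) = (if 0 < (a : ℕ) then (a : ℕ) - 1 else m - 1) then x a - x b else 0 := by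
    have hne : (if (a : ℕ) + 1 < m then (a : ℕ) + 1 else 0) ≠
        if 0 < (a : ℕ) then (a : ℕ) - 1 else m - 1 := by
      split_ifs <;> omega
    simp only [cycleGraph_adj_iff_val hm]
    by_cases h₁ : (b : ℕ) = if (a : ℕ) + 1 < m then (a : ℕ) + 1 else 0
    · rw [if_pos (Or.inl h₁), if_pos h₁, if_neg (h₁ ▸ hne), add_zero]
    · simp only [h₁, false_or, if_false, zero_add]
  have hsucc : (if (a : ℕ) + 1 < m then (a : ℕ) + 1 else 0) < m := by split_ifs <;> omega
  have hpred : (if 0 < (a : ℕ) then (a : ℕ) - 1 else m - 1) < m := by split_ifs <;> omega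
  rw [SimpleGraph.lapMatrix_mulVec_eq_sum, Finset.sum_congr rfl fun b _ => hterm b,
    Finset.sum_add_distrib, Fin.sum_ite_val_eq (fun b => x a - x b),
    Fin.sum_ite_val_eq (fun b => x a - x b), if_pos hsucc, if_pos hpred]

theorem abs_cast_succ_sub (k j : ℕ) :
    |((k + 1 : ℕ) : ℝ) - j| = |(k : ℝ) - j| + if j ≤ k then 1 else -1 := by
  push_cast
  split_ifs with h
  · have : (j : ℝ) ≤ k := by exact_mod_cast h
    rw [abs_of_nonneg (by linarith), abs_of_nonneg (by linarith)]
    ring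
  · have : (k : ℝ) + 1 ≤ j := by exact_mod_cast not_le.1 h
    rw [abs_of_nonpos (by linarith), abs_of_nonpos (by linarith)]
    ring

/-- If the Laplacians of the `φ j` agree up to the unit sinks at `j`, then the differences
`φ j - φ i` are unit current potentials. -/
theorem isUnitCurrentPotential_sub {V : Type*} [Fintype V] [DecidableEq V] (G : SimpleGraph V)
    [DecidableRel G.Adj] {φ : V → V → ℝ} {c : V → ℝ}
    (hφ : ∀ j, G.lapMatrix ℝ *ᵥ φ j = c - Pi.single j 1) (i j : V) :
    IsUnitCurrentPotential G i j (φ j - φ i) := by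
  rw [IsUnitCurrentPotential, mulVec_sub, hφ, hφ, sub_sub_sub_cancel_left]

/-- On a path `|k - j| / 2` has slope `± 1 / 2`, which changes by `1` at `j` only. -/
theorem lapMatrix_pathGraph_mulVec_abs {m : ℕ} [DecidableRel (SimpleGraph.pathGraph m).Adj]
    (j : Fin m) :
    ((SimpleGraph.pathGraph m).lapMatrix ℝ *ᵥ fun k => |((k : ℕ) : ℝ) - (j : ℕ)| / 2) =
      (fun k : Fin m => (if (k : ℕ) = 0 then 1 / 2 else 0) +
        if (k : ℕ) + 1 = m then 1 / 2 else 0) - Pi.single j 1 := by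
  ext a
  rw [lapMatrix_pathGraph_mulVec (fun k => |(k : ℝ) - (j : ℕ)| / 2)]
  have := j.isLt
  have ha := a.isLt
  simp only [Pi.sub_apply, Pi.single_apply, Fin.ext_iff, abs_cast_succ_sub]
  generalize (a : ℕ) = k at ha ⊢
  rcases k with _ | k
  · split_ifs <;> first | contradiction | omega | ring
  · simp only [abs_cast_succ_sub, Nat.add_sub_cancel]
    split_ifs <;> first | contradiction | omega | ring

/-- On a cycle of length `m`, the function `k ↦ (|k - j| - (k - j)² / m) / 2` closes up, and its
second difference is the constant `-1 / m` away from `j`. -/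
theorem lapMatrix_cycleGraph_mulVec_abs_sub_sq {m : ℕ} (hm : 3 ≤ m)
    [DecidableRel (SimpleGraph.cycleGraph m).Adj] (j : Fin m) :
    ((SimpleGraph.cycleGraph m).lapMatrix ℝ *ᵥ
        fun k => (|((k : ℕ) : ℝ) - (j : ℕ)| - (((k : ℕ) : ℝ) - (j : ℕ)) ^ 2 / m) / 2) =
      (fun _ => 1 / (m : ℝ)) - Pi.single j 1 := by
  have hm0 : (m : ℝ) ≠ 0 := by positivity
  ext a
  set x : ℕ → ℝ := fun k => (|(k : ℝ) - (j : ℕ)| - ((k : ℝ) - (j : ℕ)) ^ 2 / m) / 2 with hx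
  have hj := j.isLt
  have ha := a.isLt
  have hstep (k : ℕ) : x (k + 1) =
      x k + ((if (j : ℕ) ≤ k then 1 else -1) - (2 * ((k : ℝ) - (j : ℕ)) + 1) / m) / 2 := by
    simp only [hx, abs_cast_succ_sub]
    push_cast
    ring
  -- the wrap-around values are those of the same formula, so `hstep` applies at every vertex
  have hclose : x m = x 0 := by
    have : ((j : ℕ) : ℝ) ≤ m := by exact_mod_cast hj.le
    simp only [hx]
    rw [abs_of_nonneg (by linarith), Nat.cast_zero, zero_sub, abs_neg, abs_of_nonneg (by positivity)]
    field_simp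
    ring
  rw [lapMatrix_cycleGraph_mulVec hm x]
  have hsucc : x (if (a : ℕ) + 1 < m then (a : ℕ) + 1 else 0) = x (a + 1) := by
    split_ifs with h
    · rfl
    · rw [← hclose, show (a : ℕ) + 1 = m by omega]
  rw [hsucc, hstep, Pi.sub_apply, Pi.single_apply]
  simp only [Fin.ext_iff]
  rcases Nat.eq_zero_or_pos (a : ℕ) with h0 | h0
  · have hlast := hstep (m - 1)
    rw [Nat.sub_add_cancel (by omega), if_pos (by omega), hclose, Nat.cast_sub (by omega)] at hlast
    rw [h0, if_neg (lt_irrefl 0), eq_sub_of_add_eq hlast.symm]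
    push_cast
    split_ifs <;> first | omega | (field_simp; ring)
  · obtain ⟨k, hk⟩ := Nat.exists_eq_add_of_lt h0
    rw [zero_add] at hk
    rw [if_pos h0, hk, Nat.add_sub_cancel, hstep]
    push_cast
    split_ifs <;> first | omega | (field_simp; ring)

end RailPotentials

/-! ### Asymptotics of the two Kirchhoff indices -/

section Asymptotics

open Filter Topology

theorem sum_range_cast (m : ℕ) : ∑ i ∈ Finset.range m, (i : ℝ) = m * (m - 1) / 2 := by
  induction m with
  | zero => simp
  | succ m ih => rw [Finset.sum_range_succ, ih]; push_cast; ring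

theorem sum_range_sq_cast (m : ℕ) :
    ∑ i ∈ Finset.range m, (i : ℝ) ^ 2 = m * (m - 1) * (2 * m - 1) / 6 := by
  induction m with
  | zero => simp
  | succ m ih => rw [Finset.sum_range_succ, ih]; push_cast; ring

theorem sum_sum_abs_sub (m : ℕ) :
    ∑ i : Fin m, ∑ j : Fin m, |((i : ℕ) : ℝ) - (j : ℕ)| = ((m : ℝ) ^ 3 - m) / 3 := by
  have hinner (i : ℕ) := Fin.sum_univ_eq_sum_range (fun j : ℕ => |(i : ℝ) - j|) m
  simp only [hinner]
  rw [Fin.sum_univ_eq_sum_range (fun i => ∑ j ∈ Finset.range m, |(i : ℝ) - j|)]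
  clear hinner
  induction m with
  | zero => simp
  | succ m ih =>
    have h : ∑ j ∈ Finset.range m, |(m : ℝ) - j| = m * (m + 1) / 2 := by
      rw [Finset.sum_congr rfl fun j hj => abs_of_nonneg (sub_nonneg.2
        (Nat.cast_le.2 (Finset.mem_range.1 hj).le)), Finset.sum_sub_distrib, sum_range_cast]
      simp only [Finset.sum_const, Finset.card_range, nsmul_eq_mul]
      ring
    have h' : ∑ i ∈ Finset.range m, |(i : ℝ) - m| = m * (m + 1) / 2 := by
      simpa only [abs_sub_comm] using h
    simp only [Finset.sum_range_succ, Finset.sum_add_distrib, ih, h, h', sub_self, abs_zero]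
    push_cast
    ring

theorem sum_sum_sub_sq (m : ℕ) :
    ∑ i : Fin m, ∑ j : Fin m, (((i : ℕ) : ℝ) - (j : ℕ)) ^ 2 =
      (m : ℝ) ^ 2 * ((m : ℝ) ^ 2 - 1) / 6 := by
  have h₁ : ∑ i : Fin m, ((i : ℕ) : ℝ) = m * (m - 1) / 2 := by
    rw [Fin.sum_univ_eq_sum_range (fun i => (i : ℝ)), sum_range_cast]
  have h₂ : ∑ i : Fin m, ((i : ℕ) : ℝ) ^ 2 = m * (m - 1) * (2 * m - 1) / 6 := by
    rw [Fin.sum_univ_eq_sum_range (fun i => (i : ℝ) ^ 2), sum_range_sq_cast]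
  simp only [sub_sq, Finset.sum_add_distrib, Finset.sum_sub_distrib, ← Finset.mul_sum,
    ← Finset.sum_mul, h₁, h₂, Finset.sum_const, Finset.card_univ, Fintype.card_fin, nsmul_eq_mul]
  ring

theorem pathGraph_exists_adj_even {m : ℕ} (hm : 2 ≤ m) (a : Fin m) :
    ∃ b, (SimpleGraph.pathGraph m).Adj a b ∧ (Even (a : ℕ) ∨ Even (b : ℕ)) := by
  have := a.isLt
  simp only [SimpleGraph.pathGraph_adj, Nat.even_iff]
  by_cases h : (a : ℕ) = 0
  · exact ⟨⟨1, by omega⟩, by dsimp only; omega⟩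
  · exact ⟨⟨a - 1, by omega⟩, by dsimp only; omega⟩

theorem kirchhoffIndex_hexChain_mem_Icc {n : ℕ} (hn : 1 ≤ n) :
    kirchhoffIndex (hexChain n) ∈
      Set.Icc (((2 * n + 1 : ℕ) : ℝ) ^ 3 / 3 - ((2 * n + 1 : ℕ) : ℝ) / 3)
        (((2 * n + 1 : ℕ) : ℝ) ^ 3 / 3 - ((2 * n + 1 : ℕ) : ℝ) / 3 +
          6 * ((2 * n + 1 : ℕ) : ℝ) ^ 2) := by
  classical
  have hsum (m : ℕ) : ∑ i : Fin m, ∑ j : Fin m,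
      (|((i : ℕ) : ℝ) - (j : ℕ)| / 2 - |((i : ℕ) : ℝ) - (i : ℕ)| / 2 -
        (|((j : ℕ) : ℝ) - (j : ℕ)| / 2 - |((j : ℕ) : ℝ) - (i : ℕ)| / 2)) =
      (m : ℝ) ^ 3 / 3 - (m : ℝ) / 3 := by
    rw [← sub_div, ← sum_sum_abs_sub]
    refine Finset.sum_congr rfl fun i _ => Finset.sum_congr rfl fun j _ => ?_
    rw [abs_sub_comm ((j : ℕ) : ℝ) (i : ℕ), sub_self, sub_self, abs_zero]
    ring
  let _ : DecidableRel (evenRungs (SimpleGraph.pathGraph (2 * n + 1))).Adj :=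
    hexChain.decidableAdj n
  rw [← hsum (2 * n + 1)]
  exact kirchhoffIndex_evenRungs_mem_Icc (pathGraph_exists_adj_even (by omega))
    (isUnitCurrentPotential_sub _ lapMatrix_pathGraph_mulVec_abs)

theorem kirchhoffIndex_hexCylinder_mem_Icc {n : ℕ} (hn : 2 ≤ n) :
    kirchhoffIndex (hexCylinder n) ∈
      Set.Icc (((2 * n : ℕ) : ℝ) ^ 3 / 6 - ((2 * n : ℕ) : ℝ) / 6)
        (((2 * n : ℕ) : ℝ) ^ 3 / 6 - ((2 * n : ℕ) : ℝ) / 6 + 6 * ((2 * n : ℕ) : ℝ) ^ 2) := by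
  classical
  have hsum (m : ℕ) (hm : (m : ℝ) ≠ 0) : ∑ i : Fin m, ∑ j : Fin m,
      ((|((i : ℕ) : ℝ) - (j : ℕ)| - (((i : ℕ) : ℝ) - (j : ℕ)) ^ 2 / m) / 2 -
          (|((i : ℕ) : ℝ) - (i : ℕ)| - (((i : ℕ) : ℝ) - (i : ℕ)) ^ 2 / m) / 2 -
        ((|((j : ℕ) : ℝ) - (j : ℕ)| - (((j : ℕ) : ℝ) - (j : ℕ)) ^ 2 / m) / 2 -
          (|((j : ℕ) : ℝ) - (i : ℕ)| - (((j : ℕ) : ℝ) - (i : ℕ)) ^ 2 / m) / 2)) =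
      (m : ℝ) ^ 3 / 6 - (m : ℝ) / 6 := by
    calc _ = ∑ i : Fin m, ∑ j : Fin m,
          (|((i : ℕ) : ℝ) - (j : ℕ)| - (((i : ℕ) : ℝ) - (j : ℕ)) ^ 2 / m) := by
          refine Finset.sum_congr rfl fun i _ => Finset.sum_congr rfl fun j _ => ?_
          rw [abs_sub_comm ((j : ℕ) : ℝ) (i : ℕ), sub_self, sub_self, abs_zero]
          ring
      _ = _ := by
          simp only [Finset.sum_sub_distrib, ← Finset.sum_div]
          rw [sum_sum_abs_sub, sum_sum_sub_sq]
          field_simp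
          ring
  let _ : DecidableRel (evenRungs (SimpleGraph.cycleGraph (2 * n))).Adj :=
    hexCylinder.decidableAdj n
  rw [← hsum (2 * n) (by positivity)]
  exact kirchhoffIndex_evenRungs_mem_Icc
    (fun a => (pathGraph_exists_adj_even (by omega) a).imp fun b h =>
      ⟨SimpleGraph.pathGraph_le_cycleGraph h.1, h.2⟩)
    (isUnitCurrentPotential_sub _ (lapMatrix_cycleGraph_mulVec_abs_sub_sq (by omega)))

/-- With `N ~ 2 n`, the error terms `N / c` and `6 N²` are negligible against `n³`. -/
theorem tendsto_div_cube_of_mem_Icc {K N : ℕ → ℝ} (c : ℝ)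
    (hN : Tendsto (fun n : ℕ => N n / n) atTop (𝓝 2))
    (hK : ∀ᶠ n in atTop, K n ∈ Set.Icc (N n ^ 3 / c - N n / c)
      (N n ^ 3 / c - N n / c + 6 * N n ^ 2)) :
    Tendsto (fun n : ℕ => K n / (n : ℝ) ^ 3) atTop (𝓝 (8 / c)) := by
  have hinv : Tendsto (fun n : ℕ => (n : ℝ)⁻¹) atTop (𝓝 0) := tendsto_inv_atTop_nhds_zero_nat
  have hlow : Tendsto (fun n : ℕ => (N n / n) ^ 3 / c - N n / n / c * (n : ℝ)⁻¹ ^ 2) atTop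
      (𝓝 (8 / c)) := by
    convert ((hN.pow 3).div_const c).sub ((hN.div_const c).mul (hinv.pow 2)) using 2
    norm_num
  have hupp : Tendsto (fun n : ℕ => (N n / n) ^ 3 / c - N n / n / c * (n : ℝ)⁻¹ ^ 2 +
      6 * (N n / n) ^ 2 * (n : ℝ)⁻¹) atTop (𝓝 (8 / c)) := by
    convert hlow.add (((hN.pow 2).const_mul 6).mul hinv) using 2
    norm_num
  refine tendsto_of_tendsto_of_tendsto_of_le_of_le' hlow hupp ?_ ?_
  · filter_upwards [hK, eventually_gt_atTop 0] with n hn h0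
    have : (0 : ℝ) < n := by exact_mod_cast h0
    refine le_trans (le_of_eq ?_) (div_le_div_of_nonneg_right hn.1 (by positivity))
    field_simp
  · filter_upwards [hK, eventually_gt_atTop 0] with n hn h0
    have : (0 : ℝ) < n := by exact_mod_cast h0
    refine le_trans (div_le_div_of_nonneg_right hn.2 (by positivity)) (le_of_eq ?_)
    field_simp

end Asymptotics

theorem corollary5p3 :
    Filter.Tendsto (fun n : ℕ => kirchhoffIndex (hexCylinder n) / kirchhoffIndex (hexChain n))
      Filter.atTop (nhds (1 / 2 : ℝ)) := by
  have hchain : Filter.Tendsto (fun n : ℕ => kirchhoffIndex (hexChain n) / (n : ℝ) ^ 3)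
      Filter.atTop (nhds (8 / 3)) := by
    refine tendsto_div_cube_of_mem_Icc (N := fun n => ((2 * n + 1 : ℕ) : ℝ)) 3 ?_ ?_
    · have h := (tendsto_inv_atTop_nhds_zero_nat (𝕜 := ℝ)).const_add 2
      rw [add_zero] at h
      refine h.congr' ?_
      filter_upwards [Filter.eventually_gt_atTop 0] with n h0
      have : (n : ℝ) ≠ 0 := by exact_mod_cast h0.ne'
      push_cast
      field_simp
    · filter_upwards [Filter.eventually_ge_atTop 1] with n hn
      exact kirchhoffIndex_hexChain_mem_Icc hn
  have hcyl : Filter.Tendsto (fun n : ℕ => kirchhoffIndex (hexCylinder n) / (n : ℝ) ^ 3)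
      Filter.atTop (nhds (8 / 6)) := by
    refine tendsto_div_cube_of_mem_Icc (N := fun n => ((2 * n : ℕ) : ℝ)) 6 ?_ ?_
    · refine tendsto_const_nhds.congr' ?_
      filter_upwards [Filter.eventually_gt_atTop 0] with n h0
      have : (n : ℝ) ≠ 0 := by exact_mod_cast h0.ne'
      push_cast
      field_simp
    · filter_upwards [Filter.eventually_ge_atTop 2] with n hn
      exact kirchhoffIndex_hexCylinder_mem_Icc hn
  have h := hcyl.div hchain (by norm_num)
  rw [show (8 / 6 : ℝ) / (8 / 3) = 1 / 2 by norm_num] at h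
  refine h.congr' ?_
  filter_upwards [Filter.eventually_gt_atTop 0] with n h0
  exact div_div_div_cancel_right₀ (by positivity) _ _
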